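/- For $a\in\mathbb{N}=\{1,2,3,\ldots\}$, $b,p,c\in\mathbb{R}$ and $z\in\mathbb{C}$ let $${}_a\mathtt{B}_{b,p,c}(z)=\sum_{k=0}^{\infty}\frac{(-c)^k}{k!\,\Gamma\!\left(ak+p+\frac{b+1}{2}\right)}\left(\frac z2\right)^{2k+p}$$ be the generalized Bessel function, where powers take their principal values and $1/\Gamma$ is read as $0$ at the poles of $\Gamma$. Let $a\in\mathbb{N}$ and let $\nu\in\mathbb{R}$ satisfy $\nu>(a-1)/a$. Then all zeros $z\in\mathbb{C}$ of the function $z\mapsto{}_a\mathtt{B}_{2a-1,\,a\nu-a+1,\,1}(a^{a/2}z)$ are real. Moreover, the origin is a zero of this function, and it is its only zero in the open unit disk $\{z\in\mathbb{C}:|z|<1\}$. -/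

import Mathlib

open scoped Nat

/-- The generalized Bessel function of complex argument,
`∑ₖ (-c)ᵏ / (k! Γ(a k + p + (b + 1) / 2)) · (z / 2) ^ (2 k + p)`,
with principal powers. At a pole of `Γ` Mathlib has `Γ = 0`, so that the coefficient is `0`,
in accordance with the usual convention `1 / Γ = 0`. -/
noncomputable def genBessel (a : ℕ) (b p c : ℝ) (z : ℂ) : ℂ :=
  ∑' k : ℕ,
    (((-c) ^ k / ((k ! : ℝ) * Real.Gamma ((a : ℝ) * k + p + (b + 1) / 2)) : ℝ) : ℂ) *
      (z / 2) ^ ((2 * (k : ℝ) + p : ℝ) : ℂ)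

/-!
Away from the origin the generalized Bessel function with `c = 1` is a power of `w / 2`, which does
not vanish, times `F (-(w / 2) ^ 2)`, where `F y = ∑ y ^ k / (k! Γ(a k + β))` is entire and, for the
parameters at hand, `β = a ν + 1 > a` (`genBessel_one_eq_cpow_mul_tsum`). At the origin the power
has a positive exponent, so the function vanishes there.

All zeros of `F` are negative, by an argument of Laguerre. For `α ≥ 0` the operator
`p ↦ p + α X p'` multiplies the coefficient of `X ^ k` by `1 + α k` and keeps the zeros of a
polynomial real and negative (`HasNegRoots.add_X_mul_derivative`). Applied to `(1 + c X) ^ n` with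
`α = a / (β + j)` for `j = 0, …, n` and a suitable `c`, these operators give polynomials with
negative zeros that tend to `Γ(β) F`, by Euler's limit formula for `Γ`
(`exists_hasNegRoots_coeff_eq`). Instead of Hurwitz's theorem a quantitative bound is used: for `y`
off the half-line `(-∞, 0]` there is `B` with `|1 + t y| ≥ exp (-B t)` for all `t ≥ 0`, so that
`|∏ (1 + t y)| ≥ exp (-B ∑ t)` (`HasNegRoots.exp_neg_le_norm_eval`). Since `∑ t` is the
coefficient of `y` in the product, which stays bounded along the sequence, the bound survives in the limit.
If `z` is not real, then `-z ^ 2` is off `(-∞, 0]`; hence all zeros are real.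

In the unit disk no information on zeros is needed: `Γ(a k + β) ≥ a ^ (a k) Γ(β)` because `β ≥ a`,
so for `|y| ≤ a ^ a / 4` the constant term of `F` outweighs the sum of all the others
(`tsum_pow_div_factorial_mul_Gamma_ne_zero_of_norm_le`).
-/

open Polynomial Filter Topology

/-! ### Polynomials with negative zeros and Laguerre's operators -/

/-- A complex polynomial with value `1` at the origin all of whose zeros are negative real
numbers. Equivalently, a finite product of factors `1 + t X` with `t > 0`. -/
structure HasNegRoots (p : ℂ[X]) : Prop where
  coeff_zero : p.coeff 0 = 1
  exists_root_eq : ∀ z : ℂ, p.eval z = 0 → ∃ t : ℝ, 0 < t ∧ z = -(t : ℂ)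

theorem HasNegRoots.exists_of_mem_roots {p : ℂ[X]} (hp : HasNegRoots p) :
    ∀ r ∈ p.roots, ∃ t : ℝ, 0 < t ∧ r = -(t : ℂ) :=
  fun r hr ↦ hp.exists_root_eq r (isRoot_of_mem_roots hr)

theorem HasNegRoots.eval_zero {p : ℂ[X]} (hp : HasNegRoots p) : p.eval 0 = 1 := by
  rw [← coeff_zero_eq_eval_zero, hp.coeff_zero]

theorem HasNegRoots.ne_zero {p : ℂ[X]} (hp : HasNegRoots p) : p ≠ 0 := by
  rintro rfl
  simpa using hp.coeff_zero

theorem im_sum_inv_sub_mul_im_nonpos (w : ℂ) (s : Multiset ℂ)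
    (hs : ∀ r ∈ s, ∃ t : ℝ, 0 < t ∧ r = -(t : ℂ)) :
    ((s.map fun r ↦ 1 / (w - r)).sum).im * w.im ≤ 0 := by
  induction s using Multiset.induction with
  | empty => simp
  | cons r s ih =>
    have h1 := ih fun r hr ↦ hs r (Multiset.mem_cons_of_mem hr)
    obtain ⟨t, ht, rfl⟩ := hs r (Multiset.mem_cons_self r s)
    rw [Multiset.map_cons, Multiset.sum_cons, Complex.add_im, add_mul]
    have h2 : (1 / (w - -(t : ℂ))).im * w.im ≤ 0 := by
      rw [one_div, Complex.inv_im]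
      have : (w - -(t : ℂ)).im = w.im := by simp
      rw [this, div_mul_eq_mul_div]
      exact div_nonpos_of_nonpos_of_nonneg (by nlinarith [sq_nonneg w.im])
        (Complex.normSq_nonneg _)
    linarith

theorem re_sum_inv_sub_nonneg {w : ℂ} (hw : 0 ≤ w.re) (s : Multiset ℂ)
    (hs : ∀ r ∈ s, ∃ t : ℝ, 0 < t ∧ r = -(t : ℂ)) :
    0 ≤ ((s.map fun r ↦ 1 / (w - r)).sum).re := by
  induction s using Multiset.induction with
  | empty => simp
  | cons r s ih =>
    have h1 := ih fun r hr ↦ hs r (Multiset.mem_cons_of_mem hr)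
    obtain ⟨t, ht, rfl⟩ := hs r (Multiset.mem_cons_self r s)
    rw [Multiset.map_cons, Multiset.sum_cons, Complex.add_re]
    have h2 : 0 ≤ (1 / (w - -(t : ℂ))).re := by
      rw [one_div, Complex.inv_re]
      have : (w - -(t : ℂ)).re = w.re + t := by simp
      rw [this]
      exact div_nonneg (by linarith) (Complex.normSq_nonneg _)
    linarith

/-- Laguerre's operator `p ↦ p + α X p'`, `α ≥ 0`, keeps all zeros real and negative. At a zero
`w` of the image that is not a zero of `p`, the logarithmic derivative of `p` gives
`1 / w + α ∑ 1 / (w - r) = 0`, where `r` runs over the zeros of `p`; taking imaginary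
parts shows that `w` is real, and taking real parts that it is negative. -/
theorem HasNegRoots.add_X_mul_derivative {p : ℂ[X]} (hp : HasNegRoots p) {α : ℝ} (hα : 0 ≤ α) :
    HasNegRoots (p + C (α : ℂ) * (X * derivative p)) := by
  refine ⟨by simp [hp.coeff_zero], fun w hw ↦ ?_⟩
  by_cases hpw : p.eval w = 0
  · exact hp.exists_root_eq w hpw
  have hw0 : w ≠ 0 := by
    rintro rfl
    simp [hp.eval_zero] at hw
  have hlog := (IsAlgClosed.splits p).eval_derivative_div_eval_of_ne_zero hpw
  set S := (p.roots.map fun r ↦ 1 / (w - r)).sum with hS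
  have key : w⁻¹ + α * S = 0 := by
    rw [← hlog]
    simp only [eval_add, eval_mul, eval_C, eval_X] at hw
    field_simp
    linear_combination hw
  have hn : 0 < Complex.normSq w := Complex.normSq_pos.mpr hw0
  have him : w.im = 0 := by
    by_contra hne
    have h1 := im_sum_inv_sub_mul_im_nonpos w p.roots hp.exists_of_mem_roots
    have h2 := congrArg Complex.im key
    rw [Complex.add_im, Complex.inv_im, Complex.im_ofReal_mul, Complex.zero_im] at h2
    have h3 : 0 < w.im ^ 2 / Complex.normSq w := div_pos (by positivity) hn
    have h4 : -w.im / Complex.normSq w * w.im = -(w.im ^ 2 / Complex.normSq w) := by ring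
    have h5 := mul_nonneg_of_nonpos_of_nonpos (neg_nonpos.mpr hα) h1
    have h6 : (-w.im / Complex.normSq w + α * S.im) * w.im = 0 := by rw [h2, zero_mul]
    nlinarith
  have hre : w.re < 0 := by
    by_contra! hge
    have hpos : 0 < w.re := lt_of_le_of_ne hge fun h ↦ hw0 (Complex.ext h.symm him)
    have h1 := re_sum_inv_sub_nonneg hge p.roots hp.exists_of_mem_roots
    have h2 := congrArg Complex.re key
    rw [Complex.add_re, Complex.inv_re, Complex.re_ofReal_mul, Complex.zero_re] at h2
    have h3 := div_pos hpos hn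
    have h4 := mul_nonneg hα h1
    linarith
  exact ⟨-w.re, by linarith, Complex.ext (by simp) (by simp [him])⟩

/-- On the coefficient of `X ^ k`, the operator `p ↦ p + α X p'` is multiplication by `1 + α k`;
iterating it realizes products of such factors as multipliers. -/
theorem HasNegRoots.exists_coeff_eq_prod_mul {p : ℂ[X]} (hp : HasNegRoots p) {α : ℕ → ℝ}
    (hα : ∀ j, 0 ≤ α j) (m : ℕ) :
    ∃ q : ℂ[X], HasNegRoots q ∧
      ∀ k, q.coeff k = (∏ j ∈ Finset.range m, (1 + α j * k) : ℝ) * p.coeff k := by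
  induction m with
  | zero => exact ⟨p, hp, by simp⟩
  | succ m ih =>
    obtain ⟨q, hq, hc⟩ := ih
    refine ⟨_, hq.add_X_mul_derivative (hα m), fun k ↦ ?_⟩
    have hX : (X * derivative q).coeff k = k * q.coeff k := by
      cases k with
      | zero => simp
      | succ k =>
        rw [coeff_X_mul, coeff_derivative]
        push_cast
        ring
    rw [coeff_add, coeff_C_mul, hX, hc, Finset.prod_range_succ]
    push_cast
    ring

/-- The polynomial `(1 + c X) ^ n` has no zero other than `-1 / c`. -/
theorem hasNegRoots_one_add_X_pow_comp {c : ℝ} (hc : 0 < c) (n : ℕ) :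
    HasNegRoots (((1 + X) ^ n : ℂ[X]).comp (C (c : ℂ) * X)) := by
  refine ⟨by rw [comp_C_mul_X_coeff]; simp [coeff_one_add_X_pow], fun z hz ↦ ?_⟩
  have h : 1 + (c : ℂ) * z = 0 := by
    simp only [eval_comp, eval_pow, eval_add, eval_one, eval_X, eval_mul, eval_C] at hz
    exact eq_zero_of_pow_eq_zero hz
  refine ⟨c⁻¹, inv_pos.mpr hc, ?_⟩
  have : (c : ℂ) ≠ 0 := by exact_mod_cast hc.ne'
  push_cast
  field_simp
  linear_combination h

/-! ### Lower bounds away from the negative half-line -/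

/-- The exponential form of the bound makes it multiplicative: over a product of factors
`1 + t y`, only `∑ t` matters. -/
theorem exists_exp_neg_mul_le_norm_one_add_mul {y : ℂ} (hy : y ∈ Complex.slitPlane) :
    ∃ B : ℝ, 0 ≤ B ∧ ∀ t : ℝ, 0 ≤ t → Real.exp (-(B * t)) ≤ ‖1 + y * t‖ := by
  have hy0 : 0 < ‖y‖ := norm_pos_iff.mpr (Complex.slitPlane_ne_zero hy)
  -- The points `1 + y t` stay away from the origin, since the ray through `y` misses `-1`.
  obtain ⟨δ, hδ, hδ1, hδt⟩ : ∃ δ : ℝ, 0 < δ ∧ δ ≤ 1 ∧ ∀ t : ℝ, 0 ≤ t → δ ≤ ‖1 + y * t‖ := by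
    rcases Complex.mem_slitPlane_iff.mp hy with hre | him
    · refine ⟨1, one_pos, le_rfl, fun t ht ↦ ?_⟩
      refine le_trans ?_ (Complex.re_le_norm _)
      simp only [Complex.add_re, Complex.one_re, Complex.re_mul_ofReal]
      nlinarith [mul_nonneg hre.le ht]
    · refine ⟨|y.im| / ‖y‖, by positivity, (div_le_one hy0).mpr (Complex.abs_im_le_norm y),
        fun t ht ↦ ?_⟩
      rw [div_le_iff₀ hy0, ← norm_mul]
      -- `|Im y| = |Im (conj y (1 + y t))|`, as `conj y * y` is real.
      have h := Complex.abs_im_le_norm ((starRingEnd ℂ y) * (1 + y * t))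
      have h2 : ((starRingEnd ℂ y) * (1 + y * t)).im = -y.im := by
        simp
        ring
      rw [h2, abs_neg, norm_mul, Complex.norm_conj] at h
      rwa [norm_mul, mul_comm]
  -- With `u = ‖y‖ t` the claim follows from `exp (2 u / δ) ≥ 1 + 2 u / δ`: for `u ≤ 1 / 2` use
  -- `‖1 + y t‖ ≥ 1 - u ≥ 1 / (1 + 2 u)`, and for `u ≥ 1 / 2` use `‖1 + y t‖ ≥ δ`.
  refine ⟨2 * ‖y‖ / δ, by positivity, fun t ht ↦ ?_⟩
  rw [Real.exp_neg]
  have hexp := Real.add_one_le_exp (2 * ‖y‖ / δ * t)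
  have hpos : 0 < 2 * ‖y‖ / δ * t + 1 := by positivity
  refine (inv_anti₀ hpos hexp).trans ?_
  have hu : 0 ≤ ‖y‖ * t := by positivity
  have hE : 2 * ‖y‖ / δ * t = 2 * (‖y‖ * t) / δ := by ring
  rw [hE] at hpos ⊢
  rcases le_total (‖y‖ * t) (1 / 2) with hsmall | hlarge
  · have h1 : 1 - ‖y‖ * t ≤ ‖1 + y * t‖ := by
      have := norm_sub_le_norm_add (1 : ℂ) (y * t)
      rwa [norm_one, norm_mul, Complex.norm_real, Real.norm_of_nonneg ht] at this
    have h2 : 2 * (‖y‖ * t) ≤ 2 * (‖y‖ * t) / δ := le_div_self (by positivity) hδ hδ1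
    refine (inv_anti₀ (by positivity) (add_le_add_left h2 1)).trans (le_trans ?_ h1)
    rw [inv_le_iff_one_le_mul₀ (by positivity)]
    nlinarith
  · refine le_trans ?_ (hδt t ht)
    rw [inv_le_comm₀ hpos hδ, inv_eq_one_div]
    have : 1 / δ ≤ 2 * (‖y‖ * t) / δ := by gcongr; linarith
    linarith

theorem exp_neg_le_norm_prod_one_sub_div {y : ℂ} {B : ℝ}
    (hB : ∀ t : ℝ, 0 ≤ t → Real.exp (-(B * t)) ≤ ‖1 + y * t‖) (s : Multiset ℂ)
    (hs : ∀ r ∈ s, ∃ t : ℝ, 0 < t ∧ r = -(t : ℂ)) :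
    Real.exp (-(B * ((s.map fun r ↦ 1 / (0 - r)).sum).re)) ≤ ‖(s.map fun r ↦ 1 - y / r).prod‖ := by
  induction s using Multiset.induction with
  | empty => simp
  | cons r s ih =>
    have h1 := ih fun r hr ↦ hs r (Multiset.mem_cons_of_mem hr)
    obtain ⟨t, ht, rfl⟩ := hs r (Multiset.mem_cons_self r s)
    simp only [Multiset.map_cons, Multiset.sum_cons, Multiset.prod_cons, Complex.add_re, norm_mul]
    rw [mul_add, neg_add, Real.exp_add]
    have h2 := hB t⁻¹ (inv_nonneg.mpr ht.le)
    have h3 : (1 / (0 - -(t : ℂ))).re = t⁻¹ := by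
      rw [zero_sub, neg_neg, one_div, ← Complex.ofReal_inv, Complex.ofReal_re]
    have h4 : 1 - y / -(t : ℂ) = 1 + y * (t⁻¹ : ℝ) := by
      rw [Complex.ofReal_inv, div_neg, sub_neg_eq_add, div_eq_mul_inv]
    rw [h3, h4]
    exact mul_le_mul h2 h1 (Real.exp_pos _).le (norm_nonneg _)

/-- Since `p = ∏ (1 + t X)` with `∑ t = p.coeff 1`, a lower bound for each factor gives a lower
bound for `p` that depends on the coefficient of `X` only. -/
theorem HasNegRoots.exp_neg_le_norm_eval {p : ℂ[X]} (hp : HasNegRoots p) {y : ℂ} {B : ℝ}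
    (hB : ∀ t : ℝ, 0 ≤ t → Real.exp (-(B * t)) ≤ ‖1 + y * t‖) :
    Real.exp (-(B * (p.coeff 1).re)) ≤ ‖p.eval y‖ := by
  have hsp := IsAlgClosed.splits p
  have h0 : p.eval 0 ≠ 0 := by simp [hp.eval_zero]
  have h1 : p.coeff 1 = (p.roots.map fun r ↦ 1 / (0 - r)).sum := by
    rw [← hsp.eval_derivative_div_eval_of_ne_zero h0, hp.eval_zero, div_one,
      ← coeff_zero_eq_eval_zero, coeff_derivative]
    simp
  have h2 : p.eval y = (p.roots.map fun r ↦ 1 - y / r).prod := by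
    have e0 := hsp.eval_eq_prod_roots 0
    rw [hp.eval_zero] at e0
    rw [hsp.eval_eq_prod_roots y]
    have : (p.roots.map fun r ↦ y - r)
        = p.roots.map fun r ↦ (0 - r) * (1 - y / r) := by
      refine Multiset.map_congr rfl fun r hr ↦ ?_
      obtain ⟨t, ht, rfl⟩ := hp.exists_of_mem_roots r hr
      have : (t : ℂ) ≠ 0 := by exact_mod_cast ht.ne'
      field_simp
      ring
    rw [this, Multiset.prod_map_mul, ← mul_assoc, ← e0, one_mul]
  rw [h1, h2]
  exact exp_neg_le_norm_prod_one_sub_div hB _ hp.exists_of_mem_roots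

/-! ### Approximation through Euler's limit formula -/

theorem gammaSeq_pos {s : ℝ} (hs : 0 < s) {n : ℕ} (hn : n ≠ 0) : 0 < Real.GammaSeq s n := by
  have : (0 : ℝ) < n := by positivity
  unfold Real.GammaSeq
  refine div_pos (by positivity) (Finset.prod_pos fun j _ ↦ by positivity)

theorem gammaSeq_add_one {s : ℝ} (hs : 0 < s) {n : ℕ} (hn : n ≠ 0) :
    Real.GammaSeq (s + 1) n = n * s / (n + 1 + s) * Real.GammaSeq s n := by
  have hs0 : (s : ℂ) ≠ 0 := by exact_mod_cast hs.ne'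
  have key : ∀ x : ℝ, (Real.GammaSeq x n : ℂ) = Complex.GammaSeq x n := fun x ↦ by
    unfold Real.GammaSeq Complex.GammaSeq
    push_cast
    rw [Complex.ofReal_cpow n.cast_nonneg, Complex.ofReal_natCast]
  have h := Complex.GammaSeq_add_one_left s hn
  rw [div_eq_iff hs0] at h
  apply Complex.ofReal_injective
  push_cast
  rw [key, key]
  push_cast
  rw [h]
  ring

/-- A bound uniform in `n`, which serves to dominate the approximating series. -/
theorem gammaSeq_div_gammaSeq_add_le {s : ℝ} (hs : 1 ≤ s) {n : ℕ} (hn : n ≠ 0) (m : ℕ) :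
    Real.GammaSeq s n / Real.GammaSeq (s + m) n ≤ 3 ^ m := by
  induction m with
  | zero => simp [div_self (gammaSeq_pos (by linarith : 0 < s) hn).ne']
  | succ m ih =>
    have hsm : 1 ≤ s + m := by linarith [(Nat.cast_nonneg m : (0 : ℝ) ≤ m)]
    have h1 := gammaSeq_pos (by linarith : 0 < s + m) hn
    have h2 := gammaSeq_pos (by linarith : 0 < s + m + 1) hn
    have hn1 : (1 : ℝ) ≤ n := by exact_mod_cast Nat.one_le_iff_ne_zero.mpr hn
    have h3 : Real.GammaSeq (s + m) n / 3 ≤ Real.GammaSeq (s + m + 1) n := by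
      rw [gammaSeq_add_one (by linarith) hn, div_eq_inv_mul]
      refine mul_le_mul_of_nonneg_right ?_ h1.le
      rw [le_div_iff₀ (by linarith)]
      nlinarith
    rw [div_le_iff₀ h1] at ih
    push_cast
    rw [← add_assoc, div_le_iff₀ h2, pow_succ]
    have h4 : (0 : ℝ) < 3 ^ m := by positivity
    nlinarith

/-- The effect on the coefficient of `X ^ k` of the operators `p ↦ p + a / (β + j) X p'` for
`j = 0, …, n`, together with the rescaling `X ↦ n ^ (-a) X`. -/
theorem prod_one_add_div_mul (a k : ℕ) {β : ℝ} (hβ : 0 < β) {n : ℕ} (hn : n ≠ 0) :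
    ∏ j ∈ Finset.range (n + 1), (1 + a / (β + j) * k) =
      Real.GammaSeq β n / Real.GammaSeq (β + (a * k : ℕ)) n * (n : ℝ) ^ (a * k) := by
  have hn0 : (0 : ℝ) < n := by positivity
  have h1 : ∏ j ∈ Finset.range (n + 1), (1 + a / (β + j) * k) =
      (∏ j ∈ Finset.range (n + 1), (β + (a * k : ℕ) + j)) /
        ∏ j ∈ Finset.range (n + 1), (β + j) := by
    rw [← Finset.prod_div_distrib]
    refine Finset.prod_congr rfl fun j _ ↦ ?_
    have : β + j ≠ 0 := by positivity
    push_cast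
    field_simp
    ring
  have h2 : ∏ j ∈ Finset.range (n + 1), (β + j) ≠ 0 :=
    (Finset.prod_pos fun j _ ↦ by positivity).ne'
  have h3 : ∏ j ∈ Finset.range (n + 1), (β + (a * k : ℕ) + j) ≠ 0 :=
    (Finset.prod_pos fun j _ ↦ by positivity).ne'
  have h4 : (n : ℝ) ^ β ≠ 0 := by positivity
  have h5 : (n ! : ℝ) ≠ 0 := by positivity
  rw [h1, Real.GammaSeq, Real.GammaSeq, Real.rpow_add hn0, Real.rpow_natCast]
  field_simp

/-- The polynomials approximating the entire function `∑ y ^ k / (k! Γ(a k + β))`, up to the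
factor `Γ(β)`. They arise from `(1 + X / n) ^ n` through Laguerre's operators. -/
theorem exists_hasNegRoots_coeff_eq (a : ℕ) {β : ℝ} (hβ : 0 < β) {n : ℕ} (hn : n ≠ 0) :
    ∃ q : ℂ[X], HasNegRoots q ∧ ∀ k, q.coeff k =
      ((Real.GammaSeq β n / Real.GammaSeq (β + (a * k : ℕ)) n * (n.choose k / (n : ℝ) ^ k) : ℝ)
        : ℂ) := by
  have hn0 : (0 : ℝ) < n := by positivity
  have hc : 0 < ((n : ℝ) ^ (a + 1))⁻¹ := by positivity
  obtain ⟨q, hq, hqc⟩ := (hasNegRoots_one_add_X_pow_comp hc n).exists_coeff_eq_prod_mul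
    (α := fun j ↦ a / (β + j)) (fun j ↦ by positivity) (n + 1)
  refine ⟨q, hq, fun k ↦ ?_⟩
  rw [hqc, prod_one_add_div_mul a k hβ hn, comp_C_mul_X_coeff, coeff_one_add_X_pow,
    ← Complex.ofReal_natCast, ← Complex.ofReal_pow, ← Complex.ofReal_mul, ← Complex.ofReal_mul]
  congr 1
  have h : (((n : ℝ) ^ (a + 1))⁻¹) ^ k = ((n : ℝ) ^ (a * k))⁻¹ * ((n : ℝ) ^ k)⁻¹ := by
    rw [inv_pow, ← pow_mul, add_mul, one_mul, pow_add, mul_inv]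
  rw [h]
  field_simp

theorem tendsto_choose_div_pow (k : ℕ) :
    Tendsto (fun n : ℕ ↦ (n.choose k / (n : ℝ) ^ k : ℝ)) atTop (𝓝 (1 / k ! : ℝ)) := by
  have h := (isEquivalent_choose k).div
    (Asymptotics.IsEquivalent.refl (u := fun n : ℕ ↦ (n : ℝ) ^ k) (l := atTop))
  refine h.symm.tendsto_nhds (tendsto_const_nhds.congr' ?_)
  filter_upwards [eventually_ne_atTop 0] with n hn
  have : (n : ℝ) ^ k ≠ 0 := by positivity
  simp only [Pi.div_apply]
  field_simp

theorem choose_div_pow_le (n k : ℕ) : (n.choose k / (n : ℝ) ^ k : ℝ) ≤ 1 / k ! := by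
  refine div_le_of_le_mul₀ (by positivity) (by positivity) ?_
  have := Nat.choose_le_pow_div (α := ℝ) k n
  rwa [one_div_mul_eq_div]

/-- The function `∑ y ^ k / (k! Γ(a k + β))` does not vanish off the half-line `(-∞, 0]`: there it is
the limit of polynomials with negative zeros whose values at `y` are bounded away from `0`. -/
theorem tsum_pow_div_factorial_mul_Gamma_ne_zero (a : ℕ) {β : ℝ} (hβ : 1 ≤ β) {y : ℂ}
    (hy : y ∈ Complex.slitPlane) :
    ∑' k : ℕ, ((1 / (k ! * Real.Gamma (a * k + β)) : ℝ) : ℂ) * y ^ k ≠ 0 := by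
  have hβ0 : 0 < β := by linarith
  obtain ⟨B, hB0, hB⟩ := exists_exp_neg_mul_le_norm_one_add_mul hy
  set G : ℕ → ℕ → ℝ := fun n k ↦
    Real.GammaSeq β n / Real.GammaSeq (β + (a * k : ℕ)) n * (n.choose k / (n : ℝ) ^ k) with hG
  have hGnn : ∀ n k, n ≠ 0 → 0 ≤ G n k := fun n k hn ↦
    mul_nonneg (div_nonneg (gammaSeq_pos hβ0 hn).le (gammaSeq_pos (by positivity) hn).le)
      (by positivity)
  have hGle : ∀ n k, n ≠ 0 → G n k ≤ 3 ^ (a * k) * (1 / k !) := fun n k hn ↦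
    mul_le_mul (gammaSeq_div_gammaSeq_add_le hβ hn _) (choose_div_pow_le n k) (by positivity)
      (by positivity)
  have hlim : Tendsto (fun n ↦ ∑' k, (G n k : ℂ) * y ^ k) atTop
      (𝓝 (∑' k : ℕ, ((Real.Gamma β / Real.Gamma (β + (a * k : ℕ)) * (1 / k !) : ℝ) : ℂ) *
        y ^ k)) := by
    refine tendsto_tsum_of_dominated_convergence
      (bound := fun k ↦ (3 ^ a * ‖y‖) ^ k / k !) (Real.summable_pow_div_factorial _)
      (fun k ↦ ?_) ?_
    · refine Tendsto.mul_const _ ((Complex.continuous_ofReal.tendsto _).comp ?_)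
      exact ((Real.GammaSeq_tendsto_Gamma β).div (Real.GammaSeq_tendsto_Gamma _)
        (Real.Gamma_pos_of_pos (by positivity)).ne').mul (tendsto_choose_div_pow k)
    · filter_upwards [eventually_ne_atTop 0] with n hn k
      rw [norm_mul, Complex.norm_real, Real.norm_of_nonneg (hGnn n k hn), norm_pow, mul_pow,
        ← pow_mul]
      calc G n k * ‖y‖ ^ k ≤ 3 ^ (a * k) * (1 / k !) * ‖y‖ ^ k := by gcongr; exact hGle n k hn
        _ = _ := by ring
  have hlow : ∀ᶠ n in atTop, Real.exp (-(B * 3 ^ a)) ≤ ‖∑' k, (G n k : ℂ) * y ^ k‖ := by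
    filter_upwards [eventually_ne_atTop 0] with n hn
    obtain ⟨q, hq, hqc⟩ := exists_hasNegRoots_coeff_eq a hβ0 hn
    have h1 : ∑' k, (G n k : ℂ) * y ^ k = q.eval y := by
      rw [eval_eq_sum_range, tsum_eq_sum (s := Finset.range (q.natDegree + 1))]
      · exact Finset.sum_congr rfl fun k _ ↦ by rw [hqc]
      · intro k hk
        rw [← hqc, coeff_eq_zero_of_natDegree_lt (by simpa using hk), zero_mul]
    have h2 : (q.coeff 1).re ≤ 3 ^ a := by
      rw [hqc, Complex.ofReal_re]
      exact (hGle n 1 hn).trans_eq (by simp)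
    rw [h1]
    refine le_trans ?_ (hq.exp_neg_le_norm_eval hB)
    gcongr
  have hpos := ge_of_tendsto hlim.norm hlow
  intro h0
  -- The limit of the approximants is `Γ(β)` times the given series.
  have h2 : ∑' k : ℕ, ((Real.Gamma β / Real.Gamma (β + (a * k : ℕ)) * (1 / k !) : ℝ) : ℂ) * y ^ k
      = (Real.Gamma β : ℂ) * ∑' k : ℕ, ((1 / (k ! * Real.Gamma (a * k + β)) : ℝ) : ℂ) * y ^ k := by
    rw [← tsum_mul_left]
    refine tsum_congr fun k ↦ ?_
    rw [← mul_assoc, ← Complex.ofReal_mul]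
    rw [add_comm β]
    push_cast
    ring
  rw [h2, h0, mul_zero, norm_zero] at hpos
  exact absurd hpos (not_le.mpr (Real.exp_pos _))

/-! ### Nonvanishing in a disk -/

theorem pow_mul_Gamma_le_Gamma_add {s : ℝ} {a : ℝ} (ha : 0 < a) (hs : a ≤ s) (m : ℕ) :
    a ^ m * Real.Gamma s ≤ Real.Gamma (m + s) := by
  induction m with
  | zero => simp
  | succ m ih =>
    have hms : a ≤ m + s := by linarith [(Nat.cast_nonneg m : (0 : ℝ) ≤ m)]
    have h1 := Real.Gamma_pos_of_pos (by linarith : 0 < m + s)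
    push_cast
    rw [add_right_comm, Real.Gamma_add_one (by linarith), pow_succ', mul_assoc]
    have h2 := Real.Gamma_pos_of_pos (ha.trans_le hs)
    exact mul_le_mul hms ih (by positivity) (by linarith)

/-- For `|y| ≤ a ^ a / 4` the terms with `k ≥ 1` amount to at most `∑ (1 / 4) ^ k = 1 / 3` of the
constant term. -/
theorem tsum_pow_div_factorial_mul_Gamma_ne_zero_of_norm_le {a : ℕ} (ha : 1 ≤ a) {β : ℝ}
    (hβ : a ≤ β) {y : ℂ} (hy : ‖y‖ ≤ a ^ a / 4) :
    ∑' k : ℕ, ((1 / (k ! * Real.Gamma (a * k + β)) : ℝ) : ℂ) * y ^ k ≠ 0 := by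
  have ha0 : (0 : ℝ) < a := by exact_mod_cast ha
  have hΓ : 0 < Real.Gamma β := Real.Gamma_pos_of_pos (by linarith)
  set f : ℕ → ℂ := fun k ↦ ((1 / (k ! * Real.Gamma (a * k + β)) : ℝ) : ℂ) * y ^ k with hf
  have hle : ∀ k, ‖f k‖ ≤ (1 / Real.Gamma β) * (1 / 4) ^ k := fun k ↦ by
    have h1 := pow_mul_Gamma_le_Gamma_add ha0 hβ (a * k)
    push_cast at h1
    have h2 : (1 : ℝ) ≤ k ! := by exact_mod_cast Nat.factorial_pos k
    have h3 : (0 : ℝ) < a ^ (a * k) * Real.Gamma β := by positivity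
    have h4 : (a : ℝ) ^ (a * k) * Real.Gamma β ≤ k ! * Real.Gamma (a * k + β) :=
      h1.trans (le_mul_of_one_le_left (h3.le.trans h1) h2)
    rw [hf, norm_mul, Complex.norm_real, Real.norm_of_nonneg (one_div_nonneg.mpr (h3.le.trans h4)),
      norm_pow]
    calc 1 / (k ! * Real.Gamma (a * k + β)) * ‖y‖ ^ k
        ≤ 1 / (a ^ (a * k) * Real.Gamma β) * (a ^ a / 4) ^ k := by gcongr
      _ = _ := by
        rw [div_pow, ← pow_mul, div_pow, one_pow]
        field_simp
  have hg : HasSum (fun k : ℕ ↦ (1 / Real.Gamma β) * (1 / 4) ^ (k + 1))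
      (1 / Real.Gamma β * (1 / 3)) := by
    have := (hasSum_geometric_of_lt_one (by norm_num : (0 : ℝ) ≤ 1 / 4) (by norm_num)).mul_left
      (1 / Real.Gamma β * (1 / 4))
    convert! this using 1
    · ext k
      ring
    · ring
  have hsum : Summable f := Summable.of_norm_bounded
    ((summable_geometric_of_lt_one (by norm_num) (by norm_num)).mul_left _) hle
  have htail : ‖∑' k, f (k + 1)‖ ≤ 1 / Real.Gamma β * (1 / 3) :=
    tsum_of_norm_bounded hg fun k ↦ hle (k + 1)
  have hf0 : f 0 = ((1 / Real.Gamma β : ℝ) : ℂ) := by simp [hf]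
  intro h0
  rw [hsum.tsum_eq_zero_add, hf0] at h0
  rw [← neg_eq_of_add_eq_zero_right h0, norm_neg, Complex.norm_real,
    Real.norm_of_nonneg (by positivity)] at htail
  have : 0 < 1 / Real.Gamma β := by positivity
  linarith

/-! ### The generalized Bessel function -/

theorem genBessel_one_eq_cpow_mul_tsum (a : ℕ) (b p : ℝ) {w : ℂ} (hw : w ≠ 0) :
    genBessel a b p 1 w = (w / 2) ^ (p : ℂ) *
      ∑' k : ℕ, ((1 / (k ! * Real.Gamma (a * k + (p + (b + 1) / 2))) : ℝ) : ℂ) *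
        (-(w / 2) ^ 2) ^ k := by
  rw [genBessel, ← tsum_mul_left]
  refine tsum_congr fun k ↦ ?_
  have hw2 : w / 2 ≠ 0 := div_ne_zero hw two_ne_zero
  have h1 : (w / 2) ^ ((2 * (k : ℝ) + p : ℝ) : ℂ) = (w / 2) ^ (p : ℂ) * ((w / 2) ^ 2) ^ k := by
    rw [← pow_mul, ← Complex.cpow_natCast, ← Complex.cpow_add _ _ hw2]
    congr 1
    push_cast
    ring
  rw [h1, neg_pow ((w / 2) ^ 2), add_assoc]
  push_cast
  ring

theorem genBessel_zero (a : ℕ) (b c : ℝ) {p : ℝ} (hp : 0 < p) : genBessel a b p c 0 = 0 := by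
  rw [genBessel]
  refine (tsum_congr fun k ↦ ?_).trans tsum_zero
  have h : ((2 * (k : ℝ) + p : ℝ) : ℂ) ≠ 0 := by
    rw [Complex.ofReal_ne_zero]
    positivity
  rw [zero_div, Complex.zero_cpow h, mul_zero]

theorem neg_mul_sq_mem_slitPlane {r : ℝ} (hr : 0 < r) {z : ℂ} (hz : z.im ≠ 0) :
    -((r : ℂ) * z ^ 2) ∈ Complex.slitPlane := by
  have him : (-((r : ℂ) * z ^ 2)).im = -(r * (2 * (z.re * z.im))) := by
    rw [Complex.neg_im, Complex.im_ofReal_mul, sq, Complex.mul_im]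
    ring
  have hre : (-((r : ℂ) * z ^ 2)).re = r * (z.im * z.im - z.re * z.re) := by
    rw [Complex.neg_re, Complex.re_ofReal_mul, sq, Complex.mul_re]
    ring
  rw [Complex.mem_slitPlane_iff, him, hre]
  by_cases h : z.re = 0
  · left
    rw [h, mul_zero, sub_zero]
    exact mul_pos hr (mul_self_pos.mpr hz)
  · right
    exact neg_ne_zero.mpr (mul_ne_zero hr.ne' (mul_ne_zero two_ne_zero (mul_ne_zero h hz)))

theorem mainTheorem6 (a : ℕ) (ha : 1 ≤ a) (ν : ℝ) (hν : ((a : ℝ) - 1) / a < ν) :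
    (∀ z : ℂ,
      genBessel a (2 * a - 1) (a * ν - a + 1) 1 ((((a : ℝ) ^ ((a : ℝ) / 2) : ℝ) : ℂ) * z) = 0 →
        z.im = 0) ∧
    (∀ z : ℂ, ‖z‖ < 1 →
      (genBessel a (2 * a - 1) (a * ν - a + 1) 1 ((((a : ℝ) ^ ((a : ℝ) / 2) : ℝ) : ℂ) * z) = 0 ↔
        z = 0)) := by
  have ha0 : (0 : ℝ) < a := by exact_mod_cast ha
  have ha1 : (1 : ℝ) ≤ a := by exact_mod_cast ha
  have hν' : (a : ℝ) - 1 < a * ν := by rwa [div_lt_iff₀ ha0, mul_comm] at hν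
  set R : ℝ := (a : ℝ) ^ ((a : ℝ) / 2) with hR
  have hR0 : 0 < R := by positivity
  have hR2 : R ^ 2 = (a : ℝ) ^ a := by
    rw [hR, ← Real.rpow_natCast, ← Real.rpow_mul ha0.le, ← Real.rpow_natCast]
    congr 1
    push_cast
    ring
  -- The constant in `(R z / 2) ^ 2 = r z ^ 2`; it matches the radius `a ^ a / 4` of the disk in
  -- which the entire factor is known not to vanish.
  set r : ℝ := (a : ℝ) ^ a / 4 with hr
  have hr0 : 0 < r := by positivity
  have hsq : ∀ z : ℂ, -((R : ℂ) * z / 2) ^ 2 = -((r : ℂ) * z ^ 2) := fun z ↦ by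
    rw [hr, ← hR2]
    push_cast
    ring
  -- The assumption on `ν` says that `β = a ν + 1` exceeds `a`, equivalently that the exponent
  -- `a ν - a + 1` of the leading power is positive.
  have hβ : (a : ℝ) * ν - a + 1 + (2 * a - 1 + 1) / 2 = a * ν + 1 := by ring
  have hzero : ∀ z : ℂ, z ≠ 0 →
      genBessel a (2 * a - 1) (a * ν - a + 1) 1 ((R : ℂ) * z) = 0 →
      ∑' k : ℕ, ((1 / (k ! * Real.Gamma (a * k + (a * ν + 1))) : ℝ) : ℂ) *
        (-((r : ℂ) * z ^ 2)) ^ k = 0 := fun z hz h ↦ by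
    have hw : (R : ℂ) * z ≠ 0 := mul_ne_zero (by exact_mod_cast hR0.ne') hz
    rw [genBessel_one_eq_cpow_mul_tsum a _ _ hw, hsq, hβ] at h
    refine (mul_eq_zero.mp h).resolve_left ?_
    rw [Complex.cpow_eq_zero_iff]
    exact fun h' ↦ div_ne_zero hw two_ne_zero h'.1
  refine ⟨fun z h ↦ ?_, fun z hz ↦ ⟨fun h ↦ ?_, ?_⟩⟩
  · by_contra him
    have hz0 : z ≠ 0 := by
      rintro rfl
      exact him Complex.zero_im
    exact tsum_pow_div_factorial_mul_Gamma_ne_zero a (by linarith)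
      (neg_mul_sq_mem_slitPlane hr0 him) (hzero z hz0 h)
  · by_contra hz0
    refine tsum_pow_div_factorial_mul_Gamma_ne_zero_of_norm_le ha (by linarith) ?_ (hzero z hz0 h)
    rw [norm_neg, norm_mul, Complex.norm_real, Real.norm_of_nonneg hr0.le, norm_pow]
    exact mul_le_of_le_one_right hr0.le (pow_le_one₀ (norm_nonneg z) hz.le)
  · rintro rfl
    rw [mul_zero]
    exact genBessel_zero a _ _ (by linarith)
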